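/- **P3DM.** An instance consists of three pairwise disjoint finite sets $X,Y,Z$ with $|X|=|Y|=|Z|=q$ and a set $T\subseteq X\times Y\times Z$ such that every element of $X\cup Y\cup Z$ occurs in at most three triples of $T$ and the bipartite graph joining each triple of $T$ to its three elements is planar. The answer is YES if there is $T'\subseteq T$ such that every element of $X\cup Y\cup Z$ is contained in exactly one triple of $T'$. **UC3P.** An instance consists of three discrete probability measures $P_1,P_2,P_3$ in the Euclidean plane, each with $n$ support points (points with equal coordinates may be listed separately) of mass $1/n$ each, a bound $N\in\mathbb N$ and a bound $\Phi$. A *combination measure* $P^*$ assigns masses $w_s\ge 0$ to the triples $s=(x_1,x_2,x_3)$ of support points $x_i$ of $P_i$, such that for each $i$ and each support point $p$ of $P_i$ the masses of the triples with $x_i=p$ add up to $1/n$, and such that different triples of positive mass have different means. Its support points are the means $\bar x_s=\frac13(x_1+x_2+x_3)$ of the triples with $w_s>0$, and its transport cost is $\phi(P^*)=\sum_s w_s\sum_{i=1}^3\frac13\|\bar x_s-x_i\|^2$. The answer is YES if some combination measure has at most $N$ support points and transport cost at most $\Phi$. **Triangle path graphs.** A *3-4-5 triangle* is a right triangle with side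 lengths $3,4,5$ with one horizontal and one vertical leg. A triangle path graph $G_{TP}$ of a P3DM instance consists of points with integer coordinates in the plane, each assigned to one of three sets $P_1,P_2,P_3$, namely an *element point* for every $e\in X\cup Y\cup Z$ and, for every $t\in T$ and every element $e$ of $t$, the vertices of a *triangle path*, as follows. 1. A path is a sequence of at least two *pairs*. A pair is a $3\times4$ or $4\times 3$ axis-parallel rectangle with vertices $s,a,b,s'$, where $s,s'$ are opposite, divided into the 3-4-5 triangles $sab$ and $abs'$. The first pair of the path of $(e,t)$ has $s$ equal to the element point $e$; every later pair has $s$ equal to the vertex $s'$ of the previous pair. Each pair contributes its own three vertices $a,b,s'$, which are listed separately even where coordinates agree. 2. The first pair of each path is vertical (side of length $4$ vertical); the second is horizontal and has only one point in common with the first. 3. For each $t\in T$ the final vertices $s'$ of the three paths leading to $t$ form a 3-4-5 triangle, the *triple triangle* of $t$. 4. Two different vertices have equal coordinates only if they are vertices of type $a$ or $b$ of two pairs that are consecutive in a path or that are the first pairs of two paths with the same element point. Vertices with equal coordinates belong to the same set. 5. The vertices of each triangle $sab$, $abs'$ and of each triple triangle belong to three different sets, and each of the three sets contains $q$ element points.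 6. Vertices with different coordinates are at least $3$ apart, and no three vertices from three different sets form a right triangle with two legs of length $3$. 7. Two points of one path that do not lie on one pair or on two consecutive pairs are at least $6$ apart. Any three vertices from three different sets that do not all lie (by coordinates) on one path contain two vertices at least $6$ apart, unless they form a triple triangle or consist of an element point and vertices of first pairs of paths starting at it. Then each of $P_1,P_2,P_3$ has the same number $n$ of points, namely $q$ plus the total number of pairs. **Theorem.** Let a P3DM instance and a triangle path graph $G_{TP}$ of it be given, and take the UC3P instance whose measures are the uniform measures on the $n$-point lists $P_1,P_2,P_3$ of $G_{TP}$, with $N=n$ and $\Phi=50/9$. This UC3P instance has answer YES if and only if the P3DM instance has answer YES. -/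

import Mathlib

open Finset

noncomputable section

/-- The Euclidean plane. -/
abbrev Plane : Type := EuclideanSpace ℝ (Fin 2)

/-! ### Planar graphs -/

/-- A graph is planar if it can be drawn in the plane: distinct vertices go to distinct points,
every edge to a simple arc joining its endpoints, and an arc meets the vertices and the other
arcs at most in its own endpoints. -/
def IsPlanarGraph {V : Type*} (G : SimpleGraph V) : Prop :=
  ∃ (pos : V → Plane) (arc : Sym2 V → unitInterval → Plane),
    Function.Injective pos ∧
    (∀ e ∈ G.edgeSet, Continuous (arc e) ∧ Function.Injective (arc e)) ∧
    (∀ u v, G.Adj u v →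
      (arc s(u, v) 0 = pos u ∧ arc s(u, v) 1 = pos v) ∨
      (arc s(u, v) 0 = pos v ∧ arc s(u, v) 1 = pos u)) ∧
    (∀ e ∈ G.edgeSet, ∀ r ∈ Set.Ioo (0 : unitInterval) 1, ∀ v, arc e r ≠ pos v) ∧
    (∀ e ∈ G.edgeSet, ∀ e' ∈ G.edgeSet, e ≠ e' →
      ∀ r ∈ Set.Ioo (0 : unitInterval) 1, ∀ r' ∈ Set.Ioo (0 : unitInterval) 1,
        arc e r ≠ arc e' r')

/-! ### Planar three-dimensional matching -/

/-- The elements of the disjoint union of `X`, `Y` and `Z`. -/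
abbrev Element (X Y Z : Type*) := X ⊕ Y ⊕ Z

/-- The three elements of a triple. -/
def tripleElement {X Y Z : Type*} (t : X × Y × Z) : Fin 3 → Element X Y Z :=
  ![Sum.inl t.1, Sum.inr (Sum.inl t.2.1), Sum.inr (Sum.inr t.2.2)]

/-- The element `e` occurs in the triple `t`. -/
def OccursIn {X Y Z : Type*} (e : Element X Y Z) (t : X × Y × Z) : Prop :=
  ∃ i, tripleElement t i = e

/-- The bipartite graph with a vertex for every element and for every triple of `T`, in which a
triple is joined to the three elements that occur in it. -/
def incidenceGraph {X Y Z : Type*} (T : Finset (X × Y × Z)) :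
    SimpleGraph (Element X Y Z ⊕ T) :=
  SimpleGraph.fromRel fun a b => ∃ (e : Element X Y Z) (t : T),
    a = Sum.inl e ∧ b = Sum.inr t ∧ OccursIn e t.1

/-- An instance of planar three-dimensional matching on the ground sets `X`, `Y`, `Z`. -/
structure P3DM (X Y Z : Type*) [Fintype X] [Fintype Y] [Fintype Z] where
  /-- the given triples -/
  T : Finset (X × Y × Z)
  card_X_eq_card_Y : Fintype.card X = Fintype.card Y
  card_Y_eq_card_Z : Fintype.card Y = Fintype.card Z
  occurs_le_three : ∀ e : Element X Y Z, {t | t ∈ T ∧ OccursIn e t}.ncard ≤ 3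
  planar : IsPlanarGraph (incidenceGraph T)

/-- Some subset of the triples contains every element in exactly one triple. -/
def P3DM.IsYes {X Y Z : Type*} [Fintype X] [Fintype Y] [Fintype Z] (D : P3DM X Y Z) : Prop :=
  ∃ T' ⊆ D.T, ∀ e : Element X Y Z, ∃! t, t ∈ T' ∧ OccursIn e t

/-! ### The uniform combination 3-measure problem -/

/-- Three discrete probability measures in the plane: the `i`-th one has `n` support points
`point i p`, each of mass `1 / n`. Support points of one measure may have equal coordinates;
they are told apart by their index `p`. -/
structure UC3P where
  /-- the number of support points of each of the measures -/
  n : ℕ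
  /-- the index sets of the support points -/
  ι : Fin 3 → Type*
  [fintype : ∀ i, Fintype (ι i)]
  card_eq : ∀ i, Fintype.card (ι i) = n
  /-- the coordinates of the support points -/
  point : ∀ i, ι i → Plane

namespace UC3P

attribute [instance] UC3P.fintype

variable (U : UC3P)

/-- A tuple takes one support point from each of the measures. -/
abbrev Tuple := ∀ i, U.ι i

/-- The weighted mean of a tuple, with the weights `1 / 3`. -/
def mean (s : U.Tuple) : Plane := ∑ i, (1 / 3 : ℝ) • U.point i (s i)

/-- The cost of transporting a unit of mass from the weighted mean of a tuple to its points. -/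
def cost (s : U.Tuple) : ℝ := ∑ i, (1 / 3 : ℝ) * ‖U.mean s - U.point i (s i)‖ ^ 2

/-- A combination measure: masses on tuples that add up to the given measures, such that every
support point, that is, the weighted mean of a tuple of positive mass, sends its mass to one
tuple only. -/
structure CombinationMeasure where
  /-- the mass of a tuple -/
  mass : U.Tuple → ℝ
  mass_nonneg : ∀ s, 0 ≤ mass s
  marginal : ∀ i (p : U.ι i), (open Classical in ∑ s with s i = p, mass s) = 1 / (U.n : ℝ)
  mean_injOn : Set.InjOn U.mean {s | 0 < mass s}

variable {U}

/-- The support points of a combination measure. -/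
def CombinationMeasure.supp (P : U.CombinationMeasure) : Set Plane :=
  U.mean '' {s | 0 < P.mass s}

/-- The transport cost of a combination measure. -/
def CombinationMeasure.totalCost (P : U.CombinationMeasure) : ℝ :=
  ∑ s, U.cost s * P.mass s

variable (U)

/-- Some combination measure has at most `N` support points and transport cost at most `Φ`. -/
def IsYes (N : ℕ) (Φ : ℝ) : Prop :=
  ∃ P : U.CombinationMeasure, P.supp.ncard ≤ N ∧ P.totalCost ≤ Φ

end UC3P

/-! ### Triangle path graphs -/

/-- The squared Euclidean distance of two points with integer coordinates. -/
def sqDist (p q : ℤ × ℤ) : ℤ := (p.1 - q.1) ^ 2 + (p.2 - q.2) ^ 2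

/-- The points `c, h, v` form a 3-4-5 triangle with vertical and horizontal legs, with the right
angle at `c`, with `h` the end of the horizontal leg and `v` the end of the vertical leg. -/
def Corner345 (c h v : ℤ × ℤ) : Prop :=
  h.2 = c.2 ∧ v.1 = c.1 ∧
    ((|h.1 - c.1| = 3 ∧ |v.2 - c.2| = 4) ∨ (|h.1 - c.1| = 4 ∧ |v.2 - c.2| = 3))

/-- Three points form a 3-4-5 triangle with vertical and horizontal legs. -/
def Is345 (f : Fin 3 → ℤ × ℤ) : Prop :=
  ∃ σ : Equiv.Perm (Fin 3), Corner345 (f (σ 0)) (f (σ 1)) (f (σ 2))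

section TrianglePaths

variable {X Y Z : Type*} [Fintype X] [Fintype Y] [Fintype Z]

/-- The edges of the incidence graph: `(t, i)` joins the triple `t` to its `i`-th element. -/
abbrev P3DM.Edge (D : P3DM X Y Z) := D.T × Fin 3

/-- The element at which an edge starts. -/
def P3DM.Edge.element {D : P3DM X Y Z} (π : D.Edge) : Element X Y Z := tripleElement π.1.1 π.2

/-- The element points, and a triangle path for every edge. The path `π` consists of `len π`
rectangular pairs of triangles; the pair `k` has the vertices `start`, `hor`, `ver`, `finish`, and
its two triangles are `start, hor, ver` and `hor, ver, finish`. The first pair starts at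
the element point and every later pair starts at the finish of the previous one, so that each pair
contributes the three new vertices `hor`, `ver`, `finish`. Different vertices may have equal
coordinates. -/
structure TrianglePaths (D : P3DM X Y Z) where
  /-- the number of pairs of triangles of a path -/
  len : D.Edge → ℕ
  two_le_len : ∀ π, 2 ≤ len π
  /-- the coordinates of the vertices -/
  loc : Element X Y Z ⊕ (Σ π : D.Edge, Fin (len π) × Fin 3) → ℤ × ℤ
  /-- the one of the three sets to which a vertex is assigned -/
  part : Element X Y Z ⊕ (Σ π : D.Edge, Fin (len π) × Fin 3) → Fin 3

namespace TrianglePaths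

variable {D : P3DM X Y Z} (G : TrianglePaths D)

/-- The vertices: the element points and the three new vertices of every pair of triangles. -/
abbrev Vertex := Element X Y Z ⊕ (Σ π : D.Edge, Fin (G.len π) × Fin 3)

/-- The new vertex of a pair on the horizontal line through its start. -/
def hor (π : D.Edge) (k : Fin (G.len π)) : G.Vertex := Sum.inr ⟨π, k, 0⟩

/-- The new vertex of a pair on the vertical line through its start. -/
def ver (π : D.Edge) (k : Fin (G.len π)) : G.Vertex := Sum.inr ⟨π, k, 1⟩

/-- The vertex of a pair opposite to its start. -/
def finish (π : D.Edge) (k : Fin (G.len π)) : G.Vertex := Sum.inr ⟨π, k, 2⟩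

/-- The vertex at which a pair starts. -/
def start (π : D.Edge) (k : Fin (G.len π)) : G.Vertex :=
  if k.1 = 0 then Sum.inl π.element
  else G.finish π ⟨k.1 - 1, lt_of_le_of_lt (Nat.sub_le _ _) k.2⟩

/-- The four vertices of a pair. -/
def corner (π : D.Edge) (k : Fin (G.len π)) : Fin 4 → G.Vertex :=
  ![G.start π k, G.hor π k, G.ver π k, G.finish π k]

/-- The first pair of a path. -/
def first (π : D.Edge) : Fin (G.len π) := ⟨0, lt_of_lt_of_le (by decide) (G.two_le_len π)⟩

/-- The second pair of a path. -/
def second (π : D.Edge) : Fin (G.len π) := ⟨1, lt_of_lt_of_le (by decide) (G.two_le_len π)⟩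

/-- The last pair of a path. -/
def last (π : D.Edge) : Fin (G.len π) :=
  ⟨G.len π - 1, Nat.sub_lt (lt_of_lt_of_le (by decide) (G.two_le_len π)) (by decide)⟩

/-- The vertices of the triple triangle of `t`: the ends of the three paths that lead to `t`. The
`i`-th one represents the `i`-th element of `t`. -/
def tripleVertex (t : D.T) (i : Fin 3) : G.Vertex := G.finish (t, i) (G.last (t, i))

/-- The longer edge of the pair is vertical. -/
def IsVertical (π : D.Edge) (k : Fin (G.len π)) : Prop :=
  |(G.loc (G.ver π k)).2 - (G.loc (G.start π k)).2| = 4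

/-- The longer edge of the pair is horizontal. -/
def IsHorizontal (π : D.Edge) (k : Fin (G.len π)) : Prop :=
  |(G.loc (G.hor π k)).1 - (G.loc (G.start π k)).1| = 4

/-- The three vertices belong to three different sets. -/
def Feasible (u v w : G.Vertex) : Prop :=
  G.part u ≠ G.part v ∧ G.part u ≠ G.part w ∧ G.part v ≠ G.part w

/-- The squared distance of two vertices. -/
def sqd (u v : G.Vertex) : ℤ := sqDist (G.loc u) (G.loc v)

/-- The vertex lies on the path `π`, up to equality of coordinates. -/
def OnPath (π : D.Edge) (u : G.Vertex) : Prop := ∃ k j, G.loc u = G.loc (G.corner π k j)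

/-- The vertex belongs to the first pair of some path that starts at the element `e`. -/
def OnFirstPair (e : Element X Y Z) (u : G.Vertex) : Prop :=
  ∃ π : D.Edge, π.element = e ∧ ∃ j, u = G.corner π (G.first π) j

/-- `u` and `v` are two vertices, neither of them the start or the finish of its pair, of two pairs
that meet in a start or finish: two consecutive pairs of one path or the first pairs of two
paths that start at the same element point. -/
def IsDuplicate (u v : G.Vertex) : Prop :=
  ∃ (π π' : D.Edge) (k : Fin (G.len π)) (k' : Fin (G.len π')),
    (u = G.hor π k ∨ u = G.ver π k) ∧ (v = G.hor π' k' ∨ v = G.ver π' k') ∧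
    (G.start π k = G.start π' k' ∨ G.finish π k = G.start π' k' ∨ G.finish π' k' = G.start π k)

end TrianglePaths

/-- A triangle path graph of an instance of planar three-dimensional matching. -/
structure TrianglePathGraph (D : P3DM X Y Z) extends TrianglePaths D where
  /-- every pair is a rectangle made of two 3-4-5 triangles with a common longest side -/
  pair_start : ∀ π k, Corner345 (loc (toTrianglePaths.start π k))
    (loc (toTrianglePaths.hor π k)) (loc (toTrianglePaths.ver π k))
  pair_finish : ∀ π k, Corner345 (loc (toTrianglePaths.finish π k))
    (loc (toTrianglePaths.ver π k)) (loc (toTrianglePaths.hor π k))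
  /-- the first pair of a path is vertical -/
  first_vertical : ∀ π, toTrianglePaths.IsVertical π (toTrianglePaths.first π)
  /-- the second pair of a path is horizontal -/
  second_horizontal : ∀ π, toTrianglePaths.IsHorizontal π (toTrianglePaths.second π)
  /-- the second pair of a path meets the first one in just one vertex -/
  second_meets_first : ∀ π i j,
    loc (toTrianglePaths.corner π (toTrianglePaths.first π) i) =
      loc (toTrianglePaths.corner π (toTrianglePaths.second π) j) → i = 3 ∧ j = 0
  /-- the triple triangles are 3-4-5 triangles -/
  triple_triangle : ∀ t, Is345 fun i => loc (toTrianglePaths.tripleVertex t i)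
  /-- equal coordinates occur only for duplicate vertices -/
  duplicate : ∀ u v, u ≠ v → loc u = loc v → toTrianglePaths.IsDuplicate u v
  /-- the three sets are disjoint as sets of points of the plane -/
  part_eq : ∀ u v, loc u = loc v → part u = part v
  /-- every 3-4-5 triangle of the construction has one vertex in each of the three sets -/
  feasible_start : ∀ π k, toTrianglePaths.Feasible (toTrianglePaths.start π k)
    (toTrianglePaths.hor π k) (toTrianglePaths.ver π k)
  feasible_finish : ∀ π k, toTrianglePaths.Feasible (toTrianglePaths.hor π k)
    (toTrianglePaths.ver π k) (toTrianglePaths.finish π k)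
  feasible_triple : ∀ t, toTrianglePaths.Feasible (toTrianglePaths.tripleVertex t 0)
    (toTrianglePaths.tripleVertex t 1) (toTrianglePaths.tripleVertex t 2)
  /-- each of the three sets contains the same number of element points -/
  part_element : ∀ c, {e : Element X Y Z | part (Sum.inl e) = c}.ncard = Fintype.card X
  /-- different points are at least 3 apart -/
  three_le_dist : ∀ u v, loc u ≠ loc v → 3 ^ 2 ≤ toTrianglePaths.sqd u v
  /-- a right triangle with two legs of length 3 has two vertices in the same set -/
  not_feasible_of_legs : ∀ u v w, toTrianglePaths.sqd u v = 3 ^ 2 →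
    toTrianglePaths.sqd u w = 3 ^ 2 → toTrianglePaths.sqd v w = 3 ^ 2 + 3 ^ 2 →
    ¬ toTrianglePaths.Feasible u v w
  /-- a path keeps away from itself: two of its vertices that do not lie on a common pair or on
  two consecutive pairs are at least 6 apart -/
  path_spacing : ∀ π u v, toTrianglePaths.OnPath π u → toTrianglePaths.OnPath π v →
    (∃ k k' : Fin (len π), k.1 ≤ k'.1 + 1 ∧ k'.1 ≤ k.1 + 1 ∧
      (∃ j, loc u = loc (toTrianglePaths.corner π k j)) ∧
      (∃ j, loc v = loc (toTrianglePaths.corner π k' j))) ∨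
    6 ^ 2 ≤ toTrianglePaths.sqd u v
  /-- the paths keep away from each other: three vertices in different sets that do not lie on
  one path contain two vertices at least 6 apart, unless they are the vertices of a triple
  triangle, or an element point and vertices of the first pairs of the paths starting there -/
  spacing : ∀ u v w, toTrianglePaths.Feasible u v w →
    (∃ π, toTrianglePaths.OnPath π u ∧ toTrianglePaths.OnPath π v ∧ toTrianglePaths.OnPath π w) ∨
    (∃ e, Sum.inl e ∈ ({u, v, w} : Set _) ∧
      ∀ a ∈ ({u, v, w} : Set _), toTrianglePaths.OnFirstPair e a) ∨
    (∃ t, ({u, v, w} : Set _) = Set.range (toTrianglePaths.tripleVertex t)) ∨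
    6 ^ 2 ≤ toTrianglePaths.sqd u v ∨ 6 ^ 2 ≤ toTrianglePaths.sqd u w ∨
    6 ^ 2 ≤ toTrianglePaths.sqd v w

namespace TrianglePathGraph

variable {D : P3DM X Y Z} (G : TrianglePathGraph D)

/-- The number of points in each of the three sets. -/
def n : ℕ := Fintype.card X + ∑ π, G.len π

lemma part_pair_bijective (π : D.Edge) (k : Fin (G.len π)) :
    Function.Bijective fun j : Fin 3 => G.part (Sum.inr ⟨π, k, j⟩) := by
  have h := G.feasible_finish π k
  simp only [TrianglePaths.Feasible, TrianglePaths.hor, TrianglePaths.ver,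
    TrianglePaths.finish] at h
  rw [← Finite.injective_iff_bijective]
  obtain ⟨h₀, h₁, h₂⟩ := h
  have key : ∀ f : Fin 3 → Fin 3, f 0 ≠ f 1 → f 0 ≠ f 2 → f 1 ≠ f 2 → Function.Injective f := by
    decide
  exact key _ h₀ h₁ h₂

lemma card_part (c : Fin 3) : Fintype.card {v : G.Vertex // G.part v = c} = G.n := by
  have h : ∀ (π : D.Edge) (k : Fin (G.len π)),
      (∑ j : Fin 3, if G.part (Sum.inr ⟨π, k, j⟩) = c then 1 else 0) = 1 := by
    intro π k
    obtain ⟨j, hj, hu⟩ := (G.part_pair_bijective π k).existsUnique c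
    rw [Finset.sum_eq_single j]
    · simp only [hj, if_true]
    · intro i _ hi
      exact if_neg fun h => hi (hu i h)
    · simp
  have h' := G.part_element c
  rw [Set.ncard_eq_toFinset_card', Set.toFinset_ofPred] at h'
  rw [Fintype.card_subtype, Finset.card_filter, Fintype.sum_sum_type, ← Finset.card_filter, h',
    Fintype.sum_sigma]
  unfold n
  congr 1
  refine Finset.sum_congr rfl fun π _ => ?_
  rw [Fintype.sum_prod_type]
  simp only [h, Finset.sum_const, Finset.card_univ, Fintype.card_fin, smul_eq_mul, mul_one]

/-- The instance of the uniform combination 3-measure problem: the support points of the `c`-th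
measure are the vertices in the `c`-th set. -/
def toUC3P : UC3P where
  n := G.n
  ι c := {v : G.Vertex // G.part v = c}
  card_eq := G.card_part
  point _ v := !₂[((G.loc v.1).1 : ℝ), ((G.loc v.1).2 : ℝ)]

end TrianglePathGraph

end TrianglePaths

end

open Finset

noncomputable section

/-! ### Distances of lattice points -/

/-! The cost of a tuple is one ninth of the sum of the squared side lengths of its triangle
(`cost_eq`), and this sum is at least 50 for three vertices from three different sets
(`fifty_le_size`). When n is positive the total mass is 1, so total cost at most 50/9 forces the sum
50 on every tuple of positive mass. Such a tuple either stays within the paths of one element or is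
a triple triangle (`home_eq_or_triple_of_size`). At most n tuples cover the n points of each set, so
every point lies in exactly one of them.

The rest is counting. A pair gives one new vertex to each set, so among the vertices belonging to an
element e, the set of e has one vertex more than each other set (`card_part_home`). Tuples staying
at e use the three sets equally often, while a triple triangle takes from e at most one vertex, a
path end in the set of e. So exactly one triple triangle meets e, and the triple triangles in use
form a matching (`isYes_of_perfect`).

Conversely, given a matching, take its triple triangles, the start-side triangle of each pair on a
path to a matched triple, and the finish-side triangle of every other pair. These partition the
vertices (`cover_triangle`, `exists_triangle_cover`), all have cost 50/9, and have different
centroids (`exists_eq_of_mean_eq`). -/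

lemma sqDist_comm (p q : ℤ × ℤ) : sqDist p q = sqDist q p := by
  unfold sqDist; ring

/-- Parallelogram identity: the difference of the two sides is |p + q - 2r|². -/
lemma sqDist_le_two_mul (p q r : ℤ × ℤ) : sqDist p q ≤ 2 * (sqDist p r + sqDist q r) := by
  unfold sqDist
  nlinarith [sq_nonneg (p.1 + q.1 - 2 * r.1), sq_nonneg (p.2 + q.2 - 2 * r.2)]

/-- The point `q` is obtained from `p` by a horizontal or vertical step of length 3 or 4. -/
def AxisStep (p q : ℤ × ℤ) : Prop :=
  (q.2 = p.2 ∧ (|q.1 - p.1| = 3 ∨ |q.1 - p.1| = 4)) ∨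
    (q.1 = p.1 ∧ (|q.2 - p.2| = 3 ∨ |q.2 - p.2| = 4))

lemma abs_eq_three_or_four {x : ℤ} (h : |x| = 3 ∨ |x| = 4) :
    x = 3 ∨ x = -3 ∨ x = 4 ∨ x = -4 := by
  rcases h with h | h <;> rcases (abs_eq (by norm_num)).1 h with h | h <;> simp [h]

lemma Corner345.axisStep_hor {c h v : ℤ × ℤ} (H : Corner345 c h v) : AxisStep c h :=
  Or.inl ⟨H.1, H.2.2.imp And.left And.left⟩

lemma Corner345.axisStep_ver {c h v : ℤ × ℤ} (H : Corner345 c h v) : AxisStep c v :=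
  Or.inr ⟨H.2.1, (H.2.2.imp And.right And.right).symm⟩

lemma Corner345.sum_sqDist {c h v : ℤ × ℤ} (H : Corner345 c h v) :
    sqDist c h + sqDist c v + sqDist h v = 50 := by
  obtain ⟨h₁, h₂, H⟩ := H
  simp only [sqDist, h₁, h₂]
  have a := sq_abs (h.1 - c.1)
  have b := sq_abs (v.2 - c.2)
  rcases H with ⟨H, H'⟩ | ⟨H, H'⟩ <;> rw [H] at a <;> rw [H'] at b <;> nlinarith

/-- Two 3-4-5 triangles whose corners agree or are at least 3 apart have different centroids,
unless they agree. -/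
lemma Corner345.eq_of_sum_eq {c h v c' h' v' : ℤ × ℤ} (H : Corner345 c h v)
    (H' : Corner345 c' h' v') (far : c ≠ c' → 3 ^ 2 ≤ sqDist c c')
    (hsum : c + h + v = c' + h' + v') : c = c' ∧ h = h' ∧ v = v' := by
  obtain ⟨c₁, c₂⟩ := c
  obtain ⟨h₁, h₂⟩ := h
  obtain ⟨v₁, v₂⟩ := v
  obtain ⟨c₁', c₂'⟩ := c'
  obtain ⟨h₁', h₂'⟩ := h'
  obtain ⟨v₁', v₂'⟩ := v'
  simp only [Corner345, sqDist, Prod.mk_add_mk, Prod.mk.injEq, ne_eq] at *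
  obtain ⟨hc, vc, H⟩ := H
  obtain ⟨hc', vc', H'⟩ := H'
  obtain ⟨s₁, s₂⟩ := hsum
  have key : c₁ = c₁' ∧ c₂ = c₂' := by
    by_contra hne
    have := far hne
    -- Three times each coordinate of the centroid is three times that of the corner plus one leg of
    -- ±3 or ±4. So 3(c - c') has coordinates of size at most 8, and c - c' of size at most 2.
    have small : (c₁ - c₁') ^ 2 + (c₂ - c₂') ^ 2 ≤ 8 := by
      have a : -2 ≤ c₁ - c₁' ∧ c₁ - c₁' ≤ 2 := by
        rcases H with ⟨a, b⟩ | ⟨a, b⟩ <;> rcases H' with ⟨a', b'⟩ | ⟨a', b'⟩ <;>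
        rcases (abs_eq (by norm_num)).1 a with a | a <;>
        rcases (abs_eq (by norm_num)).1 a' with a' | a' <;> omega
      have b : -2 ≤ c₂ - c₂' ∧ c₂ - c₂' ≤ 2 := by
        rcases H with ⟨a, b⟩ | ⟨a, b⟩ <;> rcases H' with ⟨a', b'⟩ | ⟨a', b'⟩ <;>
        rcases (abs_eq (by norm_num)).1 b with b | b <;>
        rcases (abs_eq (by norm_num)).1 b' with b' | b' <;> omega
      nlinarith
    linarith
  omega

lemma Is345.sum_sqDist {f : Fin 3 → ℤ × ℤ} (H : Is345 f) {a b c : Fin 3} (hab : a ≠ b)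
    (hac : a ≠ c) (hbc : b ≠ c) :
    sqDist (f a) (f b) + sqDist (f a) (f c) + sqDist (f b) (f c) = 50 := by
  obtain ⟨σ, H⟩ := H
  have := H.sum_sqDist
  obtain ⟨a, rfl⟩ := σ.surjective a
  obtain ⟨b, rfl⟩ := σ.surjective b
  obtain ⟨c, rfl⟩ := σ.surjective c
  have c₁ := sqDist_comm (f (σ 0)) (f (σ 1))
  have c₂ := sqDist_comm (f (σ 0)) (f (σ 2))
  have c₃ := sqDist_comm (f (σ 1)) (f (σ 2))
  fin_cases a <;> fin_cases b <;> fin_cases c <;> simp at hab hac hbc ⊢ <;> linarith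

/-- In two rectangles `σ a τ b` and `τ h _ v` meeting in `τ`, the neighbours of `τ` in the second
rectangle are far from `σ` or neighbours of `σ`. -/
lemma Corner345.far_or_axisStep {σ a b τ h v x : ℤ × ℤ} (H : Corner345 σ a b)
    (Hτ : Corner345 τ b a) (H' : Corner345 τ h v) (hx : x = h ∨ x = v)
    (ha : x ≠ a → 3 ^ 2 ≤ sqDist x a) (hb : x ≠ b → 3 ^ 2 ≤ sqDist x b) :
    6 ^ 2 ≤ sqDist σ x ∨ AxisStep σ x := by
  by_cases hxa : x = a
  · exact Or.inr (hxa ▸ H.axisStep_hor)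
  by_cases hxb : x = b
  · exact Or.inr (hxb ▸ H.axisStep_ver)
  left
  specialize ha hxa
  specialize hb hxb
  -- A sum of two steps is 0, ±1, ±6, ±7 or ±8, so size at least 3 already means at least 6.
  have steps : ∀ p q : ℤ, (|p| = 3 ∨ |p| = 4) → (|q| = 3 ∨ |q| = 4) → 3 ^ 2 ≤ (p + q) ^ 2 →
      6 ^ 2 ≤ (p + q) ^ 2 := by
    intro p q hp hq hpq
    rcases abs_eq_three_or_four hp with rfl | rfl | rfl | rfl <;>
    rcases abs_eq_three_or_four hq with rfl | rfl | rfl | rfl <;> revert hpq <;> norm_num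
  obtain ⟨e₁, e₂, H⟩ := H
  obtain ⟨e₃, e₄, -⟩ := Hτ
  obtain ⟨e₅, e₆, H'⟩ := H'
  rcases hx with rfl | rfl
  -- `x` and `b` lie on the horizontal line through `τ`, and `b` is vertically aligned with `σ`.
  -- Hence `hb` bounds the horizontal offset of `x` from `σ`, which is a sum of two steps. The other
  -- case is symmetric.
  · have := steps (a.1 - σ.1) (x.1 - τ.1) (H.imp And.left And.left) (H'.imp And.left And.left)
    unfold sqDist at *
    rw [e₄] at this
    have e : τ.1 - σ.1 + (x.1 - τ.1) = x.1 - σ.1 := by ring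
    rw [e] at this
    have e' : x.2 = b.2 := by omega
    rw [e', e₂] at hb
    have := this (by linarith)
    nlinarith [sq_nonneg (σ.2 - x.2)]
  · have := steps (b.2 - σ.2) (x.2 - τ.2) (H.imp And.right And.right).symm
      (H'.imp And.right And.right).symm
    unfold sqDist at *
    rw [e₃] at this
    have e : τ.2 - σ.2 + (x.2 - τ.2) = x.2 - σ.2 := by ring
    rw [e] at this
    have e' : x.1 = a.1 := by omega
    rw [e', e₁] at ha
    have := this (by linarith)
    nlinarith [sq_nonneg (σ.1 - x.1)]

/-- Two neighbours of a point that are at least 3 apart form a triangle at least as large as a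
3-4-5 triangle, unless they form a right triangle with legs of length 3. -/
lemma AxisStep.fifty_le {p x y : ℤ × ℤ} (hx : AxisStep p x) (hy : AxisStep p y)
    (hxy : 3 ^ 2 ≤ sqDist x y) :
    50 ≤ sqDist p x + sqDist p y + sqDist x y ∨
      (sqDist p x = 3 ^ 2 ∧ sqDist p y = 3 ^ 2 ∧ sqDist x y = 3 ^ 2 + 3 ^ 2) := by
  obtain ⟨p₁, p₂⟩ := p
  obtain ⟨x₁, x₂⟩ := x
  obtain ⟨y₁, y₂⟩ := y
  obtain ⟨a, rfl⟩ : ∃ a, x₁ = p₁ + a := ⟨x₁ - p₁, by ring⟩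
  obtain ⟨b, rfl⟩ : ∃ a, x₂ = p₂ + a := ⟨x₂ - p₂, by ring⟩
  obtain ⟨c, rfl⟩ : ∃ a, y₁ = p₁ + a := ⟨y₁ - p₁, by ring⟩
  obtain ⟨d, rfl⟩ : ∃ a, y₂ = p₂ + a := ⟨y₂ - p₂, by ring⟩
  simp only [AxisStep, sqDist, add_sub_cancel_left, add_eq_left, sub_add_cancel_left,
    add_sub_add_left_eq_sub, neg_sq] at *
  -- Perpendicular steps give 36 (the exception), 50 or 64; opposite steps give at least 54;
  -- parallel steps to one side violate `hxy`.
  rcases hx with ⟨rfl, hx⟩ | ⟨rfl, hx⟩ <;> rcases hy with ⟨rfl, hy⟩ | ⟨rfl, hy⟩ <;>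
  rcases abs_eq_three_or_four hx with rfl | rfl | rfl | rfl <;>
  rcases abs_eq_three_or_four hy with rfl | rfl | rfl | rfl <;> revert hxy <;> norm_num

/-! ### The geometry of triangle path graphs -/

section TrianglePaths

variable {X Y Z : Type*} [Fintype X] [Fintype Y] [Fintype Z] {D : P3DM X Y Z}

/-! ### Homes and joints of vertices -/

namespace TrianglePaths

variable (G : TrianglePaths D)

/-- The element at which the path through a vertex starts. -/
def home : G.Vertex → Element X Y Z
  | Sum.inl e => e
  | Sum.inr v => v.1.element

/-- The vertex is the start or the finish of a pair of triangles. -/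
def IsJoint : G.Vertex → Prop
  | Sum.inl _ => True
  | Sum.inr v => v.2.2 = 2

lemma home_start (π : D.Edge) (k : Fin (G.len π)) : G.home (G.start π k) = π.element := by
  unfold start
  split_ifs <;> rfl

lemma isJoint_start (π : D.Edge) (k : Fin (G.len π)) : G.IsJoint (G.start π k) := by
  unfold start
  split_ifs <;> simp [IsJoint, finish]

lemma home_corner (π : D.Edge) (k : Fin (G.len π)) (j : Fin 4) :
    G.home (G.corner π k j) = π.element := by
  fin_cases j
  · exact G.home_start π k
  all_goals rfl

lemma start_of_val_eq_add_one {π : D.Edge} {k k' : Fin (G.len π)} (h : k'.1 = k.1 + 1) :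
    G.start π k' = G.finish π k := by
  unfold start
  rw [if_neg (by omega)]
  congr 1
  ext
  simp [h]

lemma start_eq_start_home {π π' : D.Edge} {k : Fin (G.len π)} {k' : Fin (G.len π')}
    (h : G.start π k = G.start π' k') : π.element = π'.element := by
  rw [← G.home_start π k, h, G.home_start]

variable {G}

lemma IsDuplicate.home_eq {u v : G.Vertex} (h : G.IsDuplicate u v) : G.home u = G.home v := by
  obtain ⟨π, π', k, k', hu, hv, h⟩ := h
  have hu' : G.home u = π.element := by rcases hu with rfl | rfl <;> rfl
  have hv' : G.home v = π'.element := by rcases hv with rfl | rfl <;> rfl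
  rw [hu', hv']
  rcases h with h | h | h
  · exact G.start_eq_start_home h
  · rw [← G.home_start π' k', ← h]; rfl
  · rw [← G.home_start π k, ← h]; rfl

lemma IsDuplicate.not_isJoint {u v : G.Vertex} (h : G.IsDuplicate u v) : ¬ G.IsJoint u := by
  obtain ⟨π, π', k, k', hu, -⟩ := h
  rcases hu with rfl | rfl <;> simp [IsJoint, hor, ver]

lemma Feasible.rotate {u v w : G.Vertex} (h : G.Feasible u v w) : G.Feasible v w u :=
  ⟨h.2.2, h.1.symm, h.2.1.symm⟩

end TrianglePaths

/-! ### Joints, sets, and the lower bound 50 -/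

namespace TrianglePathGraph

variable (G : TrianglePathGraph D)

lemma home_eq_of_loc_eq {u v : G.Vertex} (h : G.loc u = G.loc v) : G.home u = G.home v := by
  by_cases huv : u = v
  · rw [huv]
  · exact (G.duplicate u v huv h).home_eq

/-- Coinciding vertices are neither start nor finish of their pairs, so a joint shares its
coordinates with no other vertex. -/
lemma eq_of_loc_eq_of_isJoint {u v : G.Vertex} (hu : G.IsJoint u) (h : G.loc u = G.loc v) :
    u = v := by
  by_contra huv
  exact (G.duplicate u v huv h).not_isJoint hu

/-- Both vertices complete the same `hor`, `ver` to the three sets. Along a path, all joints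
therefore lie in the set of the element point. -/
lemma part_finish_eq_start (π : D.Edge) (k : Fin (G.len π)) :
    G.part (G.finish π k) = G.part (G.start π k) := by
  have h₁ := G.feasible_start π k
  have h₂ := G.feasible_finish π k
  simp only [TrianglePaths.Feasible] at h₁ h₂
  omega

lemma part_start (π : D.Edge) (k : Fin (G.len π)) :
    G.part (G.start π k) = G.part (Sum.inl π.element) := by
  obtain ⟨k, hk⟩ := k
  induction k with
  | zero => simp [TrianglePaths.start]
  | succ k ih =>
    rw [G.start_of_val_eq_add_one (k := ⟨k, by omega⟩) rfl, part_finish_eq_start, ih]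

lemma part_finish (π : D.Edge) (k : Fin (G.len π)) :
    G.part (G.finish π k) = G.part (Sum.inl π.element) := by
  rw [part_finish_eq_start, part_start]

lemma isJoint_iff (v : G.Vertex) : G.IsJoint v ↔ G.part v = G.part (Sum.inl (G.home v)) := by
  rcases v with e | ⟨π, k, j⟩
  · simp [TrianglePaths.IsJoint, TrianglePaths.home]
  · have h := G.feasible_finish π k
    have hf := G.part_finish π k
    simp only [TrianglePaths.Feasible, hf] at h
    simp only [TrianglePaths.IsJoint, TrianglePaths.home]
    fin_cases j
    · exact iff_of_false (by simp) h.2.1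
    · exact iff_of_false (by simp) h.2.2
    · exact iff_of_true rfl hf

/-- Of the four vertices of a pair, the ones in a set different from the set of its start are
neighbours of its start and its finish. -/
lemma corner_eq_of_part_ne {π : D.Edge} {k : Fin (G.len π)} {j : Fin 4}
    (h : G.part (G.corner π k j) ≠ G.part (Sum.inl π.element)) :
    G.corner π k j = G.hor π k ∨ G.corner π k j = G.ver π k := by
  fin_cases j
  · exact absurd (G.part_start π k) h
  · exact Or.inl rfl
  · exact Or.inr rfl
  · exact absurd (G.part_finish π k) h

lemma home_of_onPath {π : D.Edge} {u : G.Vertex} (h : G.OnPath π u) : G.home u = π.element := by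
  obtain ⟨k, j, h⟩ := h
  rw [G.home_eq_of_loc_eq h, G.home_corner]

/-- If not far apart, the two vertices lie on one pair or on consecutive pairs, and the set of `v`
makes it a `hor` or `ver`. Either `u` is a joint of the pair of `v`, or it is the far end of the
adjacent rectangle, where `Corner345.far_or_axisStep` applies. -/
lemma far_or_axisStep_of_onPath {π : D.Edge} {u v : G.Vertex} (hu : G.OnPath π u)
    (hv : G.OnPath π v) (hu' : G.IsJoint u) (huv : G.part u ≠ G.part v) :
    6 ^ 2 ≤ G.sqd u v ∨ AxisStep (G.loc u) (G.loc v) := by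
  rcases G.path_spacing π u v hu hv with ⟨k, k', h₁, h₂, ⟨j, hj⟩, ⟨j', hj'⟩⟩ | h
  swap
  · exact Or.inl h
  have hpu : G.part u = G.part (Sum.inl π.element) := by
    rw [(G.isJoint_iff u).1 hu', G.home_of_onPath hu]
  have hpv := G.part_eq _ _ hj'
  have hv' := G.corner_eq_of_part_ne (hpv ▸ hpu ▸ huv.symm)
  have hlv : G.loc v = G.loc (G.hor π k') ∨ G.loc v = G.loc (G.ver π k') := by
    rw [hj']
    exact hv'.imp (congrArg _) (congrArg _)
  have hsu : u = G.start π k ∨ u = G.finish π k := by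
    have hu'' := G.eq_of_loc_eq_of_isJoint hu' hj
    fin_cases j
    · exact Or.inl hu''
    · subst hu''
      simp [TrianglePaths.IsJoint, TrianglePaths.corner, TrianglePaths.hor] at hu'
    · subst hu''
      simp [TrianglePaths.IsJoint, TrianglePaths.corner, TrianglePaths.ver] at hu'
    · exact Or.inr hu''
  have near_start : u = G.start π k' → AxisStep (G.loc u) (G.loc v) := by
    rintro rfl
    rcases hlv with h | h <;> rw [h]
    · exact (G.pair_start π k').axisStep_hor
    · exact (G.pair_start π k').axisStep_ver
  have near_finish : u = G.finish π k' → AxisStep (G.loc u) (G.loc v) := by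
    rintro rfl
    rcases hlv with h | h <;> rw [h]
    · exact (G.pair_finish π k').axisStep_ver
    · exact (G.pair_finish π k').axisStep_hor
  obtain h | h | h : k' = k ∨ k'.1 = k.1 + 1 ∨ k.1 = k'.1 + 1 := by
    rw [Fin.ext_iff]; omega
  · subst h
    exact Or.inr (hsu.elim near_start near_finish)
  · have hs := G.start_of_val_eq_add_one h
    rcases hsu with rfl | rfl
    · exact (G.pair_start π k).far_or_axisStep (G.pair_finish π k)
        (hs ▸ G.pair_start π k') hlv (G.three_le_dist _ _) (G.three_le_dist _ _)
    · exact Or.inr (near_start hs.symm)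
  · have hs := G.start_of_val_eq_add_one h
    rcases hsu with rfl | rfl
    · exact Or.inr (near_finish hs)
    · exact (G.pair_finish π k).far_or_axisStep (G.pair_start π k)
        (hs ▸ G.pair_finish π k') hlv.symm (G.three_le_dist _ _) (G.three_le_dist _ _)

/-- The sum of the squared distances of three vertices. -/
def size (u v w : G.Vertex) : ℤ := G.sqd u v + G.sqd u w + G.sqd v w

lemma size_rotate (u v w : G.Vertex) : G.size v w u = G.size u v w := by
  unfold size TrianglePaths.sqd
  rw [sqDist_comm (G.loc v) (G.loc u), sqDist_comm (G.loc w) (G.loc u)]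
  ring

/-- One squared distance of 36 forces the other two to add up to at least 18, for a total of 54. -/
lemma size_of_far {u v w : G.Vertex}
    (h : 6 ^ 2 ≤ G.sqd u v ∨ 6 ^ 2 ≤ G.sqd u w ∨ 6 ^ 2 ≤ G.sqd v w) : 50 < G.size u v w := by
  have key : ∀ a b c : G.Vertex, 6 ^ 2 ≤ G.sqd a b → 50 < G.size a b c := by
    intro a b c h
    have := sqDist_le_two_mul (G.loc a) (G.loc b) (G.loc c)
    unfold size TrianglePaths.sqd at *
    linarith
  rcases h with h | h | h
  · exact key _ _ _ h
  · rw [← size_rotate, ← size_rotate]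
    refine key _ _ _ ?_
    unfold TrianglePaths.sqd at *
    rwa [sqDist_comm]
  · rw [← size_rotate]
    exact key _ _ _ h

lemma fifty_le_size_of_axisStep {u v w : G.Vertex} (h : G.Feasible u v w)
    (hv : AxisStep (G.loc u) (G.loc v)) (hw : AxisStep (G.loc u) (G.loc w)) :
    50 ≤ G.size u v w := by
  have hvw := G.three_le_dist v w fun h' => h.2.2 (G.part_eq _ _ h')
  refine (hv.fifty_le hw hvw).resolve_right fun ⟨h₁, h₂, h₃⟩ => ?_
  exact G.not_feasible_of_legs u v w h₁ h₂ h₃ h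

/-- One of the three vertices lies in the set of the path's element and is thus a joint; the others
are far from it or one axis step away. -/
lemma fifty_le_size_of_onPath {π : D.Edge} {u v w : G.Vertex} (h : G.Feasible u v w)
    (hu : G.OnPath π u) (hv : G.OnPath π v) (hw : G.OnPath π w) : 50 ≤ G.size u v w := by
  have key : ∀ u v w : G.Vertex, G.Feasible u v w → G.OnPath π u → G.OnPath π v →
      G.OnPath π w → G.part u = G.part (Sum.inl π.element) → 50 ≤ G.size u v w := by
    intro u v w h hu hv hw hp
    have hu' : G.IsJoint u := by rw [G.isJoint_iff, G.home_of_onPath hu, hp]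
    rcases G.far_or_axisStep_of_onPath hu hv hu' h.1 with h₁ | h₁
    · exact (G.size_of_far (Or.inl h₁)).le
    rcases G.far_or_axisStep_of_onPath hu hw hu' h.2.1 with h₂ | h₂
    · exact (G.size_of_far (Or.inr (Or.inl h₂))).le
    exact G.fifty_le_size_of_axisStep h h₁ h₂
  have hp : G.part u = G.part (Sum.inl π.element) ∨ G.part v = G.part (Sum.inl π.element) ∨
      G.part w = G.part (Sum.inl π.element) := by
    have := h.1
    have := h.2.1
    have := h.2.2
    omega
  rcases hp with hp | hp | hp
  · exact key _ _ _ h hu hv hw hp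
  · rw [← size_rotate]
    exact key _ _ _ h.rotate hv hw hu hp
  · rw [← size_rotate, ← size_rotate]
    exact key _ _ _ h.rotate.rotate hw hu hv hp

lemma axisStep_of_onFirstPair {e : Element X Y Z} {v : G.Vertex} (h : G.OnFirstPair e v)
    (hv : G.part (Sum.inl e) ≠ G.part v) : AxisStep (G.loc (Sum.inl e)) (G.loc v) := by
  obtain ⟨π, rfl, j, rfl⟩ := h
  have hs : G.start π (G.first π) = Sum.inl π.element := if_pos rfl
  rw [← hs]
  rcases G.corner_eq_of_part_ne hv.symm with h | h <;> rw [h]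
  · exact (G.pair_start π _).axisStep_hor
  · exact (G.pair_start π _).axisStep_ver

lemma fifty_le_size_of_onFirstPair {e : Element X Y Z} {u v w : G.Vertex}
    (h : G.Feasible u v w) (he : Sum.inl e ∈ ({u, v, w} : Set G.Vertex))
    (H : ∀ a ∈ ({u, v, w} : Set G.Vertex), G.OnFirstPair e a) : 50 ≤ G.size u v w := by
  have key : ∀ v w : G.Vertex, G.Feasible (Sum.inl e) v w → G.OnFirstPair e v →
      G.OnFirstPair e w → 50 ≤ G.size (Sum.inl e) v w := fun v w h hv hw =>
    G.fifty_le_size_of_axisStep h (G.axisStep_of_onFirstPair hv h.1)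
      (G.axisStep_of_onFirstPair hw h.2.1)
  have hu := H u (by simp)
  have hv := H v (by simp)
  have hw := H w (by simp)
  rcases he with rfl | rfl | rfl
  · exact key _ _ h hv hw
  · rw [← size_rotate]
    exact key _ _ h.rotate hw hu
  · rw [← size_rotate, ← size_rotate]
    exact key _ _ h.rotate.rotate hu hv

lemma size_of_tripleVertex {t : D.T} {u v w : G.Vertex} (h : G.Feasible u v w)
    (H : ({u, v, w} : Set G.Vertex) = Set.range (G.tripleVertex t)) : G.size u v w = 50 := by
  obtain ⟨a, rfl⟩ : u ∈ Set.range (G.tripleVertex t) := H ▸ by simp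
  obtain ⟨b, rfl⟩ : v ∈ Set.range (G.tripleVertex t) := H ▸ by simp
  obtain ⟨c, rfl⟩ : w ∈ Set.range (G.tripleVertex t) := H ▸ by simp
  refine (G.triple_triangle t).sum_sqDist ?_ ?_ ?_
  · rintro rfl; exact h.1 rfl
  · rintro rfl; exact h.2.1 rfl
  · rintro rfl; exact h.2.2 rfl

lemma fifty_le_size {u v w : G.Vertex} (h : G.Feasible u v w) : 50 ≤ G.size u v w := by
  rcases G.spacing u v w h with ⟨π, hu, hv, hw⟩ | ⟨e, he, H⟩ | ⟨t, H⟩ | H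
  · exact G.fifty_le_size_of_onPath h hu hv hw
  · exact G.fifty_le_size_of_onFirstPair h he H
  · exact (G.size_of_tripleVertex h H).ge
  · exact (G.size_of_far H).le

/-- A far pair makes the size exceed 50 strictly, so only the other alternatives of `spacing`
survive. -/
lemma home_eq_or_triple_of_size {u v w : G.Vertex} (h : G.Feasible u v w)
    (hs : G.size u v w = 50) : (G.home u = G.home v ∧ G.home u = G.home w) ∨
      ∃ t, ({u, v, w} : Set G.Vertex) = Set.range (G.tripleVertex t) := by
  rcases G.spacing u v w h with ⟨π, hu, hv, hw⟩ | ⟨e, -, H⟩ | H | H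
  · simp [G.home_of_onPath hu, G.home_of_onPath hv, G.home_of_onPath hw]
  · have key : ∀ a ∈ ({u, v, w} : Set G.Vertex), G.home a = e := by
      intro a ha
      obtain ⟨π, rfl, j, rfl⟩ := H a ha
      exact G.home_corner _ _ _
    simp [key u (by simp), key v (by simp), key w (by simp)]
  · exact Or.inr H
  · exact absurd hs (G.size_of_far H).ne'

end TrianglePathGraph

end TrianglePaths

/-! ### Combination measures -/

open Classical in
-- The product is not simplified to 1 because n may be 0.
lemma UC3P.CombinationMeasure.sum_mass {U : UC3P} (P : U.CombinationMeasure) :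
    ∑ s, P.mass s = U.n * (1 / (U.n : ℝ)) := by
  rw [← Finset.sum_fiberwise univ (fun s : U.Tuple => s 0) P.mass]
  simp only [P.marginal 0, Finset.sum_const, Finset.card_univ, U.card_eq 0, nsmul_eq_mul]

lemma tripleElement_injective {X Y Z : Type*} (t : X × Y × Z) :
    Function.Injective (tripleElement t) := by
  intro i j h
  fin_cases i <;> fin_cases j <;> simp [tripleElement] at h ⊢

section TrianglePaths

variable {X Y Z : Type*} [Fintype X] [Fintype Y] [Fintype Z] {D : P3DM X Y Z}

/-! ### Tuples of support points as triples of vertices -/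

namespace TrianglePathGraph

variable (G : TrianglePathGraph D)

/-- The vertices of a tuple of support points. -/
def vert (s : G.toUC3P.Tuple) (c : Fin 3) : G.Vertex := (s c).1

variable {G}

lemma part_vert (s : G.toUC3P.Tuple) (c : Fin 3) : G.part (G.vert s c) = c := (s c).2

lemma apply_eq_iff (s : G.toUC3P.Tuple) (c : Fin 3) (p : G.toUC3P.ι c) :
    s c = p ↔ G.vert s c = p.1 := Subtype.ext_iff

lemma feasible_vert (s : G.toUC3P.Tuple) :
    G.Feasible (G.vert s 0) (G.vert s 1) (G.vert s 2) := by
  simp [TrianglePaths.Feasible, part_vert]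

lemma mean_apply (s : G.toUC3P.Tuple) :
    G.toUC3P.mean s 0 = (∑ c, ((G.loc (G.vert s c)).1 : ℝ)) / 3 ∧
    G.toUC3P.mean s 1 = (∑ c, ((G.loc (G.vert s c)).2 : ℝ)) / 3 := by
  constructor <;>
  · simp only [UC3P.mean, toUC3P, vert, Fin.sum_univ_three, PiLp.add_apply, PiLp.smul_apply,
      smul_eq_mul]
    simp
    ring

/-- The squared distances to the centroid add up to a third of the squared pairwise distances; the
weight 1/3 gives the ninth. -/
lemma cost_eq (s : G.toUC3P.Tuple) :
    G.toUC3P.cost s = (G.size (G.vert s 0) (G.vert s 1) (G.vert s 2) : ℝ) / 9 := by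
  have hp : ∀ c, (G.toUC3P.point c (s c)) 0 = ((G.loc (G.vert s c)).1 : ℝ) ∧
      (G.toUC3P.point c (s c)) 1 = ((G.loc (G.vert s c)).2 : ℝ) := fun c => by
    simp [toUC3P, vert]
  simp only [UC3P.cost, EuclideanSpace.norm_sq_eq, Fin.sum_univ_two, PiLp.sub_apply,
    Real.norm_eq_abs, sq_abs, (mean_apply s).1, (mean_apply s).2, (hp _).1, (hp _).2,
    Fin.sum_univ_three, size, TrianglePaths.sqd, sqDist]
  push_cast
  ring

lemma fifty_div_nine_le_cost (s : G.toUC3P.Tuple) : 50 / 9 ≤ G.toUC3P.cost s := by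
  rw [cost_eq]
  have : (50 : ℝ) ≤ (G.size (G.vert s 0) (G.vert s 1) (G.vert s 2) : ℝ) := by
    exact_mod_cast G.fifty_le_size (feasible_vert s)
  linarith

lemma part_tripleVertex (t : D.T) (i : Fin 3) :
    G.part (G.tripleVertex t i) = G.part (Sum.inl (tripleElement t.1 i)) :=
  G.part_finish (t, i) _

lemma tripleVertex_left_eq {t t' : D.T} {i i' : Fin 3}
    (h : G.tripleVertex t i = G.tripleVertex t' i') : t = t' := by
  simp only [TrianglePaths.tripleVertex, TrianglePaths.finish, Sum.inr.injEq,
    Sigma.mk.injEq, Prod.mk.injEq] at h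
  exact h.1.1

/-! ### From a combination measure to a matching -/

open Classical in
-- Every pair has one new vertex in each set; only the element point breaks the tie.
lemma card_part_home (e : Element X Y Z) (c : Fin 3) :
    #{v : G.Vertex | G.part v = c ∧ G.home v = e} =
      (if G.part (Sum.inl e) = c then 1 else 0) +
        ∑ π : D.Edge, if π.element = e then G.len π else 0 := by
  have h : ∀ (π : D.Edge) (k : Fin (G.len π)),
      (∑ j : Fin 3, if G.part (Sum.inr ⟨π, k, j⟩) = c ∧ π.element = e then 1 else 0) =
        if π.element = e then 1 else 0 := by
    intro π k
    obtain ⟨j, hj, hu⟩ := (G.part_pair_bijective π k).existsUnique c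
    rw [Finset.sum_eq_single j]
    · simp only [hj, true_and]
    · intro i _ hi
      exact if_neg fun h => hi (hu i h.1)
    · simp
  rw [Finset.card_filter, Fintype.sum_sum_type, Fintype.sum_sigma]
  congr 1
  · rw [Finset.sum_eq_single e]
    · simp [TrianglePaths.home]
    · intro e' _ he
      exact if_neg fun h => he h.2
    · simp
  · refine Finset.sum_congr rfl fun π _ => ?_
    rw [Fintype.sum_prod_type]
    refine (Finset.sum_congr rfl fun k _ => h π k).trans ?_
    split_ifs <;> simp

variable (G) in
/-- The vertices of the tuple are the vertices of the triple triangle of `t`. -/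
def IsTripleTuple (s : G.toUC3P.Tuple) (t : D.T) : Prop :=
  Set.range (G.vert s) = Set.range (G.tripleVertex t)

/-- Corners of a triple triangle are path ends, which lie in the sets of their elements. -/
lemma IsTripleTuple.eq_part {s : G.toUC3P.Tuple} {t : D.T} (h : G.IsTripleTuple s t)
    (c : Fin 3) : c = G.part (Sum.inl (G.home (G.vert s c))) := by
  obtain ⟨i, hi⟩ : G.vert s c ∈ Set.range (G.tripleVertex t) := h ▸ ⟨c, rfl⟩
  conv_lhs => rw [← part_vert s c, ← hi, part_tripleVertex]
  rw [← hi]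
  rfl

lemma home_eq_or_isTripleTuple {s : G.toUC3P.Tuple} (h : G.toUC3P.cost s = 50 / 9) :
    (∀ c c', G.home (G.vert s c) = G.home (G.vert s c')) ∨ ∃ t, G.IsTripleTuple s t := by
  rw [cost_eq] at h
  have h' : G.size (G.vert s 0) (G.vert s 1) (G.vert s 2) = 50 := by
    have : (G.size (G.vert s 0) (G.vert s 1) (G.vert s 2) : ℝ) = 50 := by linarith
    exact_mod_cast this
  rcases G.home_eq_or_triple_of_size (feasible_vert s) h' with ⟨h₁, h₂⟩ | ⟨t, ht⟩
  · left
    have : ∀ c, G.home (G.vert s c) = G.home (G.vert s 0) := by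
      intro c
      fin_cases c
      · rfl
      · exact h₁.symm
      · exact h₂.symm
    intro c c'
    rw [this c, this c']
  · right
    refine ⟨t, Eq.trans ?_ ht⟩
    ext v
    simp only [Set.mem_range, Fin.exists_fin_succ, Set.mem_insert_iff, Set.mem_singleton_iff]
    simp [eq_comm]

open Classical in
/-- Tuples of minimal cost that contain every vertex exactly once yield a matching. -/
lemma isYes_of_perfect (S : Finset G.toUC3P.Tuple)
    (hcost : ∀ s ∈ S, G.toUC3P.cost s = 50 / 9)
    (hinj : ∀ c, ∀ s ∈ S, ∀ s' ∈ S, G.vert s c = G.vert s' c → s = s')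
    (hsurj : ∀ v : G.Vertex, ∃ s ∈ S, G.vert s (G.part v) = v) : D.IsYes := by
  have hcard : ∀ e c, #{s ∈ S | G.home (G.vert s c) = e} =
      (if G.part (Sum.inl e) = c then 1 else 0) +
        ∑ π : D.Edge, if π.element = e then G.len π else 0 := by
    intro e c
    rw [← card_part_home e c]
    refine Finset.card_bij (fun s _ => G.vert s c) ?_ ?_ ?_
    · intro s hs
      simpa [part_vert] using (Finset.mem_filter.1 hs).2
    · intro s hs s' hs' h
      exact hinj c s (Finset.mem_filter.1 hs).1 s' (Finset.mem_filter.1 hs').1 h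
    · intro v hv
      obtain ⟨-, rfl, rfl⟩ := Finset.mem_filter.1 hv
      obtain ⟨s, hs, h⟩ := hsurj v
      exact ⟨s, Finset.mem_filter.2 ⟨hs, by rw [h]⟩, h⟩
  have hne : ∀ c : Fin 3, c + 1 ≠ c := by decide
  -- By the counts, exactly one tuple meets `e` in the set of `e` but not in the set `c + 1`, which
  -- serves as an arbitrary other set.
  have hone : ∀ e, ∃ s ∈ S, G.home (G.vert s (G.part (Sum.inl e))) = e ∧
      G.home (G.vert s (G.part (Sum.inl e) + 1)) ≠ e ∧
      ∀ s' ∈ S, G.home (G.vert s' (G.part (Sum.inl e))) = e →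
        G.home (G.vert s' (G.part (Sum.inl e) + 1)) ≠ e → s' = s := by
    intro e
    have h₁ := hcard e (G.part (Sum.inl e))
    have h₂ := hcard e (G.part (Sum.inl e) + 1)
    rw [if_pos rfl] at h₁
    rw [if_neg (hne _).symm, zero_add] at h₂
    -- A tuple meeting `e` outside the set of `e` is no triple triangle, so it stays at `e`.
    have hsub : {s ∈ S | G.home (G.vert s (G.part (Sum.inl e) + 1)) = e} ⊆
        {s ∈ S | G.home (G.vert s (G.part (Sum.inl e))) = e} := by
      intro s hs
      obtain ⟨hs, he⟩ := Finset.mem_filter.1 hs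
      refine Finset.mem_filter.2 ⟨hs, ?_⟩
      rcases home_eq_or_isTripleTuple (hcost s hs) with h | ⟨t, h⟩
      · rw [← he]; exact h _ _
      · have := h.eq_part (G.part (Sum.inl e) + 1)
        rw [he] at this
        exact absurd this (hne _)
    have h₃ := Finset.card_sdiff_add_card_eq_card hsub
    rw [h₁, h₂, Nat.add_right_cancel_iff] at h₃
    obtain ⟨s, hs⟩ := Finset.card_eq_one.1 h₃
    have hmem : ∀ s', s' ∈ S ∧ G.home (G.vert s' (G.part (Sum.inl e))) = e ∧
        G.home (G.vert s' (G.part (Sum.inl e) + 1)) ≠ e ↔ s' = s := by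
      intro s'
      rw [← Finset.mem_singleton (a := s), ← hs, Finset.mem_sdiff, Finset.mem_filter, Finset.mem_filter]
      tauto
    obtain ⟨h, h', h''⟩ := (hmem s).2 rfl
    exact ⟨s, h, h', h'', fun s' a b c => (hmem s').1 ⟨a, b, c⟩⟩
  refine ⟨{t ∈ D.T | ∃ ht : t ∈ D.T, ∃ s ∈ S, G.IsTripleTuple s ⟨t, ht⟩},
    Finset.filter_subset _ _, fun e => ?_⟩
  obtain ⟨s, hs, h₁, h₂, hu⟩ := hone e
  obtain ⟨t, ht⟩ := (home_eq_or_isTripleTuple (hcost s hs)).resolve_left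
    fun h => h₂ ((h _ _).trans h₁)
  obtain ⟨i, hi⟩ : G.vert s (G.part (Sum.inl e)) ∈ Set.range (G.tripleVertex t) := ht ▸ ⟨_, rfl⟩
  refine ⟨t.1, ⟨Finset.mem_filter.2 ⟨t.2, t.2, s, hs, ht⟩, i, ?_⟩, ?_⟩
  · rw [← h₁, ← hi]; rfl
  · rintro t' ⟨ht', i', rfl⟩
    obtain ⟨-, htT, s', hs', hst⟩ := Finset.mem_filter.1 ht'
    obtain ⟨c, hc⟩ : G.tripleVertex ⟨t', htT⟩ i' ∈ Set.range (G.vert s') := by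
      rw [hst]; exact ⟨_, rfl⟩
    have hc' : c = G.part (Sum.inl (tripleElement t' i')) := by
      rw [← part_vert s' c, hc, part_tripleVertex]
    subst hc'
    -- Any selected triple containing the element yields a tuple with the property defining `s`, so
    -- it is `s` itself, and a tuple determines its triple triangle.
    have hss := hu s' hs' (by rw [hc]; rfl) fun h => by
      have := hst.eq_part (G.part (Sum.inl (tripleElement t' i')) + 1)
      rw [h] at this
      exact hne _ this
    subst hss
    exact congrArg Subtype.val (tripleVertex_left_eq (hc.symm.trans hi.symm))

open Classical in
lemma isYes_of_toUC3P_isYes (h : G.toUC3P.IsYes G.n (50 / 9)) : D.IsYes := by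
  obtain ⟨P, hsupp, htotal⟩ := h
  have hn : G.toUC3P.n = G.n := rfl
  -- For n = 0 the total mass is 0 and the averaging argument fails, but there are no elements and
  -- the empty matching works.
  rcases Nat.eq_zero_or_pos G.n with hn0 | hpos
  · have hX : Fintype.card X = 0 := by unfold n at hn0; omega
    have hY : Fintype.card Y = 0 := D.card_X_eq_card_Y ▸ hX
    have hZ : Fintype.card Z = 0 := D.card_Y_eq_card_Z ▸ hY
    rw [Fintype.card_eq_zero_iff] at hX hY hZ
    exact ⟨∅, Finset.empty_subset _, fun e => isEmptyElim e⟩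
  have hpos' : (0 : ℝ) < G.n := by exact_mod_cast hpos
  have hmass : ∑ s, P.mass s = 1 := by
    rw [P.sum_mass, hn]
    field_simp
  have hcost : ∀ s, 0 < P.mass s → G.toUC3P.cost s = 50 / 9 := by
    have hnonneg : ∀ s ∈ univ, 0 ≤ (G.toUC3P.cost s - 50 / 9) * P.mass s := fun s _ =>
      mul_nonneg (sub_nonneg.2 (fifty_div_nine_le_cost s)) (P.mass_nonneg s)
    have hzero : ∑ s, (G.toUC3P.cost s - 50 / 9) * P.mass s = 0 := by
      refine le_antisymm ?_ (Finset.sum_nonneg hnonneg)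
      simp only [sub_mul, Finset.sum_sub_distrib, ← Finset.mul_sum, hmass]
      unfold UC3P.CombinationMeasure.totalCost at htotal
      linarith
    intro s hs
    have := (Finset.sum_eq_zero_iff_of_nonneg hnonneg).1 hzero s (Finset.mem_univ s)
    rcases mul_eq_zero.1 this with h | h
    · linarith
    · exact absurd h hs.ne'
  set S : Finset G.toUC3P.Tuple := {s | 0 < P.mass s} with hS
  have hScard : #S ≤ G.n := by
    have : P.supp = ↑(S.image G.toUC3P.mean) := by
      simp [UC3P.CombinationMeasure.supp, hS]
    rw [this, Set.ncard_coe_finset, Finset.card_image_of_injOn] at hsupp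
    · exact hsupp
    · simpa [hS] using P.mean_injOn
  have hsurj : ∀ c (p : G.toUC3P.ι c), ∃ s ∈ S, s c = p := by
    intro c p
    have hp := P.marginal c p
    rw [hn] at hp
    have : 0 < ∑ s with s c = p, P.mass s := by rw [hp]; positivity
    obtain ⟨s, hs, hs'⟩ := Finset.exists_lt_of_sum_lt (f := fun _ => (0 : ℝ)) (by simpa using this)
    exact ⟨s, by simpa [hS] using hs', (Finset.mem_filter.1 hs).2⟩
  refine isYes_of_perfect S (fun s hs => hcost s (by simpa [hS] using hs)) ?_ ?_
  · intro c s hs s' hs' h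
    -- Each coordinate map from `S` onto the n points of a set is a surjection from at most n
    -- tuples, hence injective.
    have hle : #S ≤ #(univ : Finset (G.toUC3P.ι c)) := by
      rw [Finset.card_univ, G.toUC3P.card_eq, hn]
      exact hScard
    exact Finset.inj_on_of_surj_on_of_card_le (fun s _ => s c) (fun _ _ => Finset.mem_univ _)
      (fun p _ => by obtain ⟨s, hs, h⟩ := hsurj c p; exact ⟨s, hs, h⟩) hle hs hs' (Subtype.ext h)
  · intro v
    obtain ⟨s, hs, h⟩ := hsurj (G.part v) ⟨v, rfl⟩
    exact ⟨s, hs, congrArg Subtype.val h⟩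

end TrianglePathGraph

end TrianglePaths

section TrianglePaths

variable {X Y Z : Type*} [Fintype X] [Fintype Y] [Fintype Z] {D : P3DM X Y Z}

namespace TrianglePathGraph

variable (G : TrianglePathGraph D)

/-! ### From a matching to a combination measure -/

/-- Labels for the triangles of the construction: one for every triple triangle, and one for
every pair of triangles, of which a given matching selects one. -/
abbrev TriangleLabel := D.T ⊕ Σ π : D.Edge, Fin (G.len π)

variable (T' : Finset (X × Y × Z))

open Classical in
/-- The triangle with a given label: the first one of a pair on a path to a triple of `T'`,
the second one of a pair on any other path. -/
def triangle : G.TriangleLabel → Fin 3 → G.Vertex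
  | Sum.inl t => G.tripleVertex t
  | Sum.inr ⟨π, k⟩ =>
    ![G.hor π k, G.ver π k, if π.1.1 ∈ T' then G.start π k else G.finish π k]

/-- The triple triangles are selected only for the triples of `T'`. -/
def IsSelected : G.TriangleLabel → Prop
  | Sum.inl t => t.1 ∈ T'
  | Sum.inr _ => True

open Classical in
/-- The label of the selected triangle that contains a given vertex. Here `pick e` is the edge
that joins the element `e` to a triple of `T'`. -/
def cover (pick : Element X Y Z → D.Edge) : G.Vertex → G.TriangleLabel
  | Sum.inl e => Sum.inr ⟨pick e, G.first (pick e)⟩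
  | Sum.inr ⟨π, k, j⟩ =>
    if j = 2 ∧ π.1.1 ∈ T' then
      if h : k.1 + 1 < G.len π then Sum.inr ⟨π, k.1 + 1, h⟩ else Sum.inl π.1
    else Sum.inr ⟨π, k⟩

lemma triangle_is345 (l : G.TriangleLabel) : Is345 fun a => G.loc (G.triangle T' l a) := by
  rcases l with t | ⟨π, k⟩
  · exact G.triple_triangle t
  · by_cases h : π.1.1 ∈ T'
    -- The right angle sits at the start, which is stored last: the permutation sends 0, 1, 2 to 2,
    -- 0, 1.
    · refine ⟨finRotate 3 * finRotate 3, ?_⟩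
      simpa [triangle, h, finRotate_apply] using G.pair_start π k
    · refine ⟨Equiv.swap 0 2, ?_⟩
      simpa [triangle, h, Equiv.swap_apply_def] using G.pair_finish π k

lemma part_triangle_bijective (l : G.TriangleLabel) :
    Function.Bijective fun a => G.part (G.triangle T' l a) := by
  have key : ∀ f : Fin 3 → Fin 3, f 0 ≠ f 1 → f 0 ≠ f 2 → f 1 ≠ f 2 → Function.Injective f := by
    decide
  rw [← Finite.injective_iff_bijective]
  rcases l with t | ⟨π, k⟩
  · obtain ⟨h₁, h₂, h₃⟩ := G.feasible_triple t
    exact key _ h₁ h₂ h₃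
  · by_cases h : π.1.1 ∈ T'
    · obtain ⟨h₁, h₂, h₃⟩ := G.feasible_start π k
      exact key _ (by simpa [triangle] using h₃) (by simpa [triangle, h] using h₁.symm)
        (by simpa [triangle, h] using h₂.symm)
    · obtain ⟨h₁, h₂, h₃⟩ := G.feasible_finish π k
      exact key _ (by simpa [triangle] using h₁) (by simpa [triangle, h] using h₂)
        (by simpa [triangle, h] using h₃)

lemma exists_isJoint_triangle (l : G.TriangleLabel) : ∃ a, G.IsJoint (G.triangle T' l a) := by
  refine ⟨2, ?_⟩
  rcases l with t | ⟨π, k⟩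
  · rfl
  · by_cases h : π.1.1 ∈ T'
    · simpa [triangle, h] using G.isJoint_start π k
    · simp [triangle, h, TrianglePaths.IsJoint, TrianglePaths.finish]

/-- The tuple of support points formed by the vertices of a triangle. -/
def triangleTuple (l : G.TriangleLabel) : G.toUC3P.Tuple := fun c =>
  ⟨G.triangle T' l ((Equiv.ofBijective _ (G.part_triangle_bijective T' l)).symm c),
    (Equiv.ofBijective _ (G.part_triangle_bijective T' l)).apply_symm_apply c⟩

variable {G T'}

lemma vert_triangleTuple (l : G.TriangleLabel) (c : Fin 3) :
    G.vert (G.triangleTuple T' l) c =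
      G.triangle T' l ((Equiv.ofBijective _ (G.part_triangle_bijective T' l)).symm c) := rfl

lemma vert_triangleTuple_part (l : G.TriangleLabel) (a : Fin 3) :
    G.vert (G.triangleTuple T' l) (G.part (G.triangle T' l a)) = G.triangle T' l a := by
  rw [vert_triangleTuple]
  congr 1
  exact (Equiv.ofBijective _ (G.part_triangle_bijective T' l)).symm_apply_apply a

lemma cost_triangleTuple (l : G.TriangleLabel) :
    G.toUC3P.cost (G.triangleTuple T' l) = 50 / 9 := by
  have h : G.size (G.vert (G.triangleTuple T' l) 0) (G.vert (G.triangleTuple T' l) 1)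
      (G.vert (G.triangleTuple T' l) 2) = 50 := by
    simp only [vert_triangleTuple]
    exact (G.triangle_is345 T' l).sum_sqDist (by simp) (by simp) (by simp)
  rw [cost_eq, h]
  norm_num

lemma sum_vert_triangleTuple (l : G.TriangleLabel) :
    ∑ c, G.loc (G.vert (G.triangleTuple T' l) c) = ∑ a, G.loc (G.triangle T' l a) :=
  Equiv.sum_comp (Equiv.ofBijective _ (G.part_triangle_bijective T' l)).symm
    fun a => G.loc (G.triangle T' l a)

/-- Two triangles with equal centroids share a vertex. -/
lemma exists_eq_of_mean_eq {l l' : G.TriangleLabel}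
    (h : G.toUC3P.mean (G.triangleTuple T' l) = G.toUC3P.mean (G.triangleTuple T' l')) :
    ∃ a a', G.triangle T' l a = G.triangle T' l' a' := by
  have hsum : ∑ a, G.loc (G.triangle T' l a) = ∑ a, G.loc (G.triangle T' l' a) := by
    rw [← sum_vert_triangleTuple, ← sum_vert_triangleTuple]
    have h₁ := (mean_apply (G.triangleTuple T' l)).1
    have h₂ := (mean_apply (G.triangleTuple T' l)).2
    rw [h, (mean_apply (G.triangleTuple T' l')).1] at h₁
    rw [h, (mean_apply (G.triangleTuple T' l')).2] at h₂
    ext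
    · rw [Prod.fst_sum, Prod.fst_sum]
      have : ∑ c, ((G.loc (G.vert (G.triangleTuple T' l) c)).1 : ℝ) =
          ∑ c, ((G.loc (G.vert (G.triangleTuple T' l') c)).1 : ℝ) := by linarith
      exact_mod_cast this
    · rw [Prod.snd_sum, Prod.snd_sum]
      have : ∑ c, ((G.loc (G.vert (G.triangleTuple T' l) c)).2 : ℝ) =
          ∑ c, ((G.loc (G.vert (G.triangleTuple T' l') c)).2 : ℝ) := by linarith
      exact_mod_cast this
  obtain ⟨σ, hσ⟩ := G.triangle_is345 T' l
  obtain ⟨σ', hσ'⟩ := G.triangle_is345 T' l'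
  rw [← Equiv.sum_comp σ, ← Equiv.sum_comp σ' fun a => G.loc (G.triangle T' l' a), Fin.sum_univ_three, Fin.sum_univ_three] at hsum
  obtain ⟨h₀, h₁, h₂⟩ := hσ.eq_of_sum_eq hσ' (G.three_le_dist _ _) hsum
  -- The corners now agree in coordinates only; at a joint this means equality of vertices.
  obtain ⟨a, ha⟩ := G.exists_isJoint_triangle T' l
  obtain ⟨b, rfl⟩ := σ.surjective a
  refine ⟨σ b, σ' b, G.eq_of_loc_eq_of_isJoint ha ?_⟩
  fin_cases b
  · exact h₀
  · exact h₁
  · exact h₂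

/-! ### The selected triangles partition the vertices -/

section Cover

variable {pick : Element X Y Z → D.Edge}

lemma cover_triangle
    (hpick : ∀ π : D.Edge, π.1.1 ∈ T' → pick π.element = π) {l : G.TriangleLabel}
    (hl : G.IsSelected T' l) (a : Fin 3) : G.cover T' pick (G.triangle T' l a) = l := by
  rcases l with t | ⟨π, k⟩
  · have ht : t.1 ∈ T' := hl
    have := G.two_le_len (t, a)
    simp only [triangle, TrianglePaths.tripleVertex, TrianglePaths.finish, TrianglePaths.last,
      cover, ht]
    rw [if_pos ⟨trivial, trivial⟩, dif_neg (by omega)]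
  · fin_cases a
    · simp [triangle, TrianglePaths.hor, cover]
    · simp [triangle, TrianglePaths.ver, cover]
    · by_cases h : π.1.1 ∈ T'
      · obtain ⟨k, hk⟩ := k
        cases k with
        -- The first pair starts at the element point, whose label is given by `pick`; later pairs
        -- start at the previous finish.
        | zero =>
          simp only [triangle, h, TrianglePaths.start, cover, TrianglePaths.first]
          simp only [Fin.reduceFinMk, Matrix.cons_val, if_true]
          rw [hpick π h]
        | succ k =>
          simp [triangle, h, TrianglePaths.start, TrianglePaths.finish, cover, hk]
      · simp [triangle, h, TrianglePaths.finish, cover]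

lemma isSelected_cover (v : G.Vertex) : G.IsSelected T' (G.cover T' pick v) := by
  rcases v with e | ⟨π, k, j⟩
  · trivial
  · simp only [cover]
    split_ifs with h h'
    · trivial
    · exact h.2
    · trivial

lemma exists_triangle_cover (hpick₁ : ∀ e, (pick e).1.1 ∈ T')
    (hpick₂ : ∀ e, (pick e).element = e) (v : G.Vertex) :
    ∃ a, G.triangle T' (G.cover T' pick v) a = v := by
  rcases v with e | ⟨π, k, j⟩
  · refine ⟨2, ?_⟩
    simp [cover, triangle, hpick₁ e, TrianglePaths.start, TrianglePaths.first, hpick₂ e]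
  · by_cases h : j = 2 ∧ π.1.1 ∈ T'
    · by_cases hk : k.1 + 1 < G.len π
      · refine ⟨2, ?_⟩
        simp [cover, h, hk, triangle, TrianglePaths.start, TrianglePaths.finish]
      -- The finish of the last pair is the corner of the triple triangle numbered by the element's
      -- place in the triple.
      · refine ⟨π.2, ?_⟩
        have hlast : G.last π = k := by
          have := k.2
          ext
          simp only [TrianglePaths.last]
          omega
        simp only [cover, if_pos h, dif_neg hk, triangle, TrianglePaths.tripleVertex, hlast, h.1]
        rfl
    · refine ⟨j, ?_⟩
      simp only [cover, if_neg h, triangle]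
      fin_cases j
      · rfl
      · rfl
      · have h' : π.1.1 ∉ T' := fun h' => h ⟨rfl, h'⟩
        simp [h', TrianglePaths.finish]

end Cover

/-- The matched triple at an element is unique, and an element occupies only one place in it, so the
edge is unique too. -/
lemma exists_pick (hsub : T' ⊆ D.T) (hT' : ∀ e : Element X Y Z, ∃! t, t ∈ T' ∧ OccursIn e t) :
    ∃ pick : Element X Y Z → D.Edge, (∀ e, (pick e).1.1 ∈ T') ∧
      (∀ e, (pick e).element = e) ∧ ∀ π : D.Edge, π.1.1 ∈ T' → pick π.element = π := by
  have h : ∀ e, ∃ π : D.Edge, π.1.1 ∈ T' ∧ π.element = e := by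
    intro e
    obtain ⟨t, ⟨ht, i, hi⟩, -⟩ := hT' e
    exact ⟨(⟨t, hsub ht⟩, i), ht, hi⟩
  choose pick hpick using h
  refine ⟨pick, fun e => (hpick e).1, fun e => (hpick e).2, fun π hπ => ?_⟩
  obtain ⟨h₁, h₂⟩ := hpick π.element
  have ht : (pick π.element).1.1 = π.1.1 :=
    (hT' π.element).unique ⟨h₁, _, h₂⟩ ⟨hπ, _, rfl⟩
  refine Prod.ext (Subtype.ext ht) (tripleElement_injective π.1.1 ?_)
  rw [← ht]
  exact h₂.trans (by rw [ht]; rfl)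

open Classical in
lemma toUC3P_isYes_of_isYes (h : D.IsYes) : G.toUC3P.IsYes G.n (50 / 9) := by
  obtain ⟨T', hsub, hT'⟩ := h
  obtain ⟨pick, hp₁, hp₂, hp₃⟩ := exists_pick hsub hT'
  set S : Set G.toUC3P.Tuple := G.triangleTuple T' '' {l | G.IsSelected T' l} with hS
  have hmem : ∀ {s}, s ∈ S → ∀ c, s = G.triangleTuple T' (G.cover T' pick (G.vert s c)) := by
    rintro _ ⟨l, hl, rfl⟩ c
    rw [vert_triangleTuple, cover_triangle hp₃ hl]
  have hcov : ∀ v : G.Vertex,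
      G.vert (G.triangleTuple T' (G.cover T' pick v)) (G.part v) = v := by
    intro v
    obtain ⟨a, ha⟩ := exists_triangle_cover hp₁ hp₂ v
    have := vert_triangleTuple_part (T' := T') (G.cover T' pick v) a
    rwa [ha] at this
  let P : G.toUC3P.CombinationMeasure :=
    { mass := fun s => if s ∈ S then 1 / (G.n : ℝ) else 0
      mass_nonneg := fun s => by split_ifs <;> positivity
      marginal := by
        rintro c ⟨v, rfl⟩
        rw [Finset.sum_eq_single (G.triangleTuple T' (G.cover T' pick v))]
        · exact if_pos ⟨_, isSelected_cover v, rfl⟩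
        · intro s hs hne
          refine if_neg fun hsS => hne ?_
          rw [hmem hsS (G.part v), (apply_eq_iff _ _ _).1 (Finset.mem_filter.1 hs).2]
        · intro h
          refine absurd ?_ h
          rw [Finset.mem_filter]
          exact ⟨Finset.mem_univ _, (apply_eq_iff _ _ _).2 (hcov v)⟩
      mean_injOn := by
        have hpos : ∀ s, (0 : ℝ) < (if s ∈ S then 1 / (G.n : ℝ) else 0) → s ∈ S := by
          intro s hs
          by_contra h
          rw [if_neg h] at hs
          exact lt_irrefl _ hs
        intro s hs s' hs' h
        obtain ⟨l, hl, rfl⟩ := hpos s hs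
        obtain ⟨l', hl', rfl⟩ := hpos s' hs'
        obtain ⟨a, a', haa⟩ := exists_eq_of_mean_eq h
        rw [← cover_triangle hp₃ hl a, haa, cover_triangle hp₃ hl' a'] }
  have hP : ∀ s, P.mass s ≠ 0 → s ∈ S := fun s hs => by
    by_contra h
    exact hs (if_neg h)
  refine ⟨P, ?_, ?_⟩
  -- A selected triangle is determined by its vertex in set 0, so there are at most n of them.
  · have hsupp : P.supp ⊆ Set.range fun p : G.toUC3P.ι 0 =>
        G.toUC3P.mean (G.triangleTuple T' (G.cover T' pick p.1)) := by
      rintro _ ⟨s, hs, rfl⟩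
      exact ⟨s 0, congrArg _ (hmem (hP s hs.ne') 0).symm⟩
    refine (Set.ncard_le_ncard hsupp (Set.finite_range _)).trans ?_
    rw [← Set.image_univ]
    refine (Set.ncard_image_le Set.finite_univ).trans ?_
    rw [Set.ncard_univ, Nat.card_eq_fintype_card, G.toUC3P.card_eq]
    exact le_rfl
  · have hcost : ∀ s, G.toUC3P.cost s * P.mass s = 50 / 9 * P.mass s := by
      intro s
      by_cases hs : P.mass s = 0
      · rw [hs, mul_zero, mul_zero]
      · obtain ⟨l, -, rfl⟩ := hP s hs
        rw [cost_triangleTuple]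
    rw [UC3P.CombinationMeasure.totalCost, Finset.sum_congr rfl fun s _ => hcost s,
      ← Finset.mul_sum, P.sum_mass, mul_one_div]
    -- Only n/n ≤ 1 is needed, which also covers n = 0.
    have := div_self_le_one (G.toUC3P.n : ℝ)
    linarith

end TrianglePathGraph

end TrianglePaths

end

theorem theorem6 {X Y Z : Type*} [Fintype X] [Fintype Y] [Fintype Z]
    (D : P3DM X Y Z) (G : TrianglePathGraph D) :
    G.toUC3P.IsYes G.n (50 / 9) ↔ D.IsYes :=
  ⟨TrianglePathGraph.isYes_of_toUC3P_isYes, TrianglePathGraph.toUC3P_isYes_of_isYes⟩
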